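/- For $y,z\in\mathbb{R}^d$ write $y\prec z$ if $y_j<z_j$ for every $j=1,\dots,d$, and $z_+:=z_1+\cdots+z_d$. For $g\in\mathbb{R}$ let $x(g):=(g/d,\dots,g/d)\in\mathbb{R}^d$, and let $\mathcal{K}_g$ be the number of points $y$ with $y\prec x(g)$ that are maxima (that is, $y\not\prec z$ for every point $z$ of the process) in a Poisson point process on $\mathbb{R}^d$ with intensity function $z\mapsto \mathbf{1}(x(g)\not\prec z)\,e^{-z_+}$ with respect to Lebesgue measure. Let $\mathcal{K}(d)$ be a random variable whose law is the mixture $\mathbb{E}\,\mathcal{L}(\mathcal{K}_G)$, where $G$ has the standard Gumbel distribution, with density $e^{-g}\exp(-e^{-g})$, $g\in\mathbb{R}$. **Theorem.** Fix an integer $d\ge 2$. Then $$\mathbb{P}(\mathcal{K}(d)\ge k)\le \exp\left[-\Omega\left(k^{(d-1)/(d^2-2)}\right)\right]\quad\text{as } k\to\infty;$$ that is, there is a constant $c>0$, depending only on $d$, such that $\mathbb{P}(\mathcal{K}(d)\ge k)\le \exp\left[-c\,k^{(d-1)/(d^2-2)}\right]$ for all sufficiently large integers $k$. -/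

import Mathlib

open MeasureTheory ProbabilityTheory

namespace ParetoRecords

/-- A Poisson point process with (diffuse) intensity measure `Λ`, as a random countable set `S`
on the probability space `(Ω, P)`: writing `N(B)` for the number of points of `S` in `B`,
* every count `N(B)`, `B` measurable, is a random variable;
* `N(B)` is Poisson with mean `Λ B` if `Λ B < ∞`, and is a.s. infinite if `Λ B = ∞`;
* the counts of finitely many pairwise disjoint measurable sets are independent. -/
structure IsPoissonProcess {E Ω : Type*} [MeasurableSpace E] [MeasurableSpace Ω]
    (Λ : Measure E) (P : Measure Ω) (S : Ω → Set E) : Prop where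
  isProbabilityMeasure : IsProbabilityMeasure P
  countable : ∀ ω, (S ω).Countable
  measurable_count : ∀ B : Set E, MeasurableSet B → Measurable fun ω => (S ω ∩ B).encard
  hasLaw_count : ∀ B : Set E, MeasurableSet B → Λ B ≠ ⊤ →
    HasLaw (fun ω => (S ω ∩ B).encard)
      ((poissonMeasure (Λ B).toNNReal).map (fun n : ℕ => (n : ℕ∞))) P
  count_eq_top : ∀ B : Set E, MeasurableSet B → Λ B = ⊤ → ∀ᵐ ω ∂P, (S ω ∩ B).encard = ⊤
  indep_count : ∀ (n : ℕ) (B : Fin n → Set E), (∀ i, MeasurableSet (B i)) →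
    Pairwise (fun i j => Disjoint (B i) (B j)) →
    iIndepFun (fun i ω => (S ω ∩ B i).encard) P

/-- The point `x(g) = (g / d, …, g / d)` of `ℝ^d`. -/
noncomputable def xPoint (d : ℕ) (g : ℝ) : Fin d → ℝ := fun _ => g / d

/-- The measure on `ℝ^d` with density `z ↦ 1(z ⊁ x(g)) exp (-(z_1 + ⋯ + z_d))` with respect to
Lebesgue measure; `StrongLT y z` says that `y j < z j` for every coordinate `j`. -/
noncomputable def intensity (d : ℕ) (g : ℝ) : Measure (Fin d → ℝ) :=
  volume.withDensity
    ({z | ¬ StrongLT (xPoint d g) z}.indicator fun z => ENNReal.ofReal (Real.exp (-∑ j, z j)))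

/-- The number of maxima of the set `S` that are dominated by `x`; a maximum of `S` is a point of
`S` that is not strictly below another point of `S` in all coordinates. -/
noncomputable def numMaximaBelow {d : ℕ} (S : Set (Fin d → ℝ)) (x : Fin d → ℝ) : ℕ∞ :=
  {y | y ∈ S ∧ (∀ z ∈ S, ¬ StrongLT y z) ∧ StrongLT y x}.encard

/-- `ν` is the law of `𝒦_g`, the number of maxima dominated by `x(g)` in a Poisson point process
with intensity `intensity d g`. (This law does not depend on the realization of the process.) -/
def IsLawOfKg (d : ℕ) (g : ℝ) (ν : Measure ℕ∞) : Prop :=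
  ∃ (Ω : Type) (_ : MeasurableSpace Ω) (P : Measure Ω) (S : Ω → Set (Fin d → ℝ)),
    IsPoissonProcess (intensity d g) P S ∧
      HasLaw (fun ω => numMaximaBelow (S ω) (xPoint d g)) ν P

/-- The standard Gumbel distribution, with density `g ↦ exp (-g) * exp (-exp (-g))`. -/
noncomputable def gumbelMeasure : Measure ℝ :=
  volume.withDensity fun g => ENNReal.ofReal (Real.exp (-g) * Real.exp (-Real.exp (-g)))

/-- `μ` is the law of `𝒦(d)`: the mixture `E ℒ(𝒦_G)` of the laws of the `𝒦_g`, where `G` is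
standard Gumbel. -/
def IsLawOfK (d : ℕ) (μ : Measure ℕ∞) : Prop :=
  ∃ κ : Kernel ℝ ℕ∞, (∀ g, IsLawOfKg d g (κ g)) ∧ μ = gumbelMeasure.bind κ

end ParetoRecords

/-! The bound proved is the stronger `exp (-c k^(1/d))`; since `d (d - 1) ≤ d² - 2` for `d ≥ 2`, it
implies the stated one.

Tile the orthant below `x(g)` by unit boxes, the cell of `n ∈ ℕ^d` having top corner `x(g) - n`. Up
to a factor `e^d`, its mass is at most its weight `w(n) = exp (-g + |n|)`, where `|n| = ∑ n_j`. A
maximum in this cell forces the box diagonally above to be empty, which has probability at most `exp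
(-e^(-d) w(n))` if `n ≠ 0`.

Take a threshold `t` of order `k^(1/d)`. The light cells, `w(n) < t`, have total mass `O(t^d)`, at
most `k / 4`, so they hold `k` points with probability at most `exp (-k / 2)`
(`sum_filter_mul_exp_sum_le`, `poissonMeasure_tail_le`). A union bound shows that maxima in the
heavy cells have probability `O(e^g exp (-e^(-d) t / 2))` (`measure_inter_unitBox_eq_empty_le`).
Both bounds hold for `-log t < g ≤ t` (`measure_numMaximaBelow_ge_le`). The Gumbel law gives mass
only `O(exp (-e^(-d) t / 4))` to the values of `g` outside `(-log t, e^(-d) t / 4]`, and inside it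
`e^g` costs at most half of the exponent. -/

namespace ParetoRecords

open scoped NNReal ENNReal Nat

/-! ### Poisson tails and counts -/

/-- Chernoff bound for the upper tail of the Poisson distribution. -/
theorem poissonMeasure_tail_le (r : ℝ≥0) (k : ℕ) (h : 4 * (r : ℝ) ≤ k) :
    poissonMeasure r {n | k ≤ n} ≤ ENNReal.ofReal (Real.exp (-(k / 2 : ℝ))) := by
  have hsum : HasSum (fun n : ℕ => Real.exp (-k) * Real.exp (-r) *
      ((Real.exp 1 * r) ^ n / n !)) (Real.exp (-k) * Real.exp (-r) * Real.exp (Real.exp 1 * r)) := by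
    have := NormedSpace.expSeries_div_hasSum_exp (Real.exp 1 * (r : ℝ))
    rw [← Real.exp_eq_exp_ℝ] at this
    exact this.mul_left _
  have hterm : ∀ n : ℕ, (ENNReal.ofReal (Real.exp (-r) * r ^ n / (n)!) • Measure.dirac n :
      Measure ℕ) {n | k ≤ n} ≤ ENNReal.ofReal (Real.exp (-k) * Real.exp (-r) *
      ((Real.exp 1 * r) ^ n / n !)) := by
    intro n
    rw [Measure.smul_apply, Measure.dirac_apply' _ (by measurability), smul_eq_mul]
    by_cases hn : k ≤ n
    · rw [Set.indicator_of_mem (by exact hn), Pi.one_apply, mul_one]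
      apply ENNReal.ofReal_le_ofReal
      have h1 : 1 ≤ Real.exp (-k) * Real.exp 1 ^ n := by
        rw [← Real.exp_nat_mul, ← Real.exp_add]
        apply Real.one_le_exp
        have : (k : ℝ) ≤ n := by exact_mod_cast hn
        linarith
      calc Real.exp (-r) * r ^ n / (n)! = 1 * (Real.exp (-r) * r ^ n / (n)!) := by ring
        _ ≤ (Real.exp (-k) * Real.exp 1 ^ n) * (Real.exp (-r) * r ^ n / (n)!) := by gcongr
        _ = _ := by rw [mul_pow]; ring
    · rw [Set.indicator_of_notMem (by exact hn)]; simp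
  rw [poissonMeasure, Measure.sum_apply _ (by measurability)]
  refine (ENNReal.tsum_le_tsum hterm).trans ?_
  rw [← ENNReal.ofReal_tsum_of_nonneg (fun n => by positivity) hsum.summable, hsum.tsum_eq]
  apply ENNReal.ofReal_le_ofReal
  rw [← Real.exp_add, ← Real.exp_add]
  apply Real.exp_le_exp.2
  -- The exponent is `-k + (e - 1) r`, and `(e - 1) / 4 < 1 / 2`.
  have := Real.exp_one_lt_d9
  nlinarith [r.2]

section Counts

variable {E Ω : Type*} [MeasurableSpace E] [MeasurableSpace Ω] {Λ : Measure E} {P : Measure Ω}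
  {S : Ω → Set E}

theorem IsPoissonProcess.measure_le_encard_le (h : IsPoissonProcess Λ P S) {B : Set E}
    (hB : MeasurableSet B) (k : ℕ) (hk : Λ B ≤ ENNReal.ofReal (k / 4)) :
    P {ω | (k : ℕ∞) ≤ (S ω ∩ B).encard} ≤ ENNReal.ofReal (Real.exp (-(k / 2 : ℝ))) := by
  have htop : Λ B ≠ ⊤ := ne_top_of_le_ne_top ENNReal.ofReal_ne_top hk
  have h1 := (h.hasLaw_count B hB htop).measure_eq (p := fun j => (k : ℕ∞) ≤ j)
    (MeasurableSet.of_discrete)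
  rw [h1, Measure.map_apply (by fun_prop) MeasurableSet.of_discrete]
  have h2 : (fun n : ℕ => (n : ℕ∞)) ⁻¹' {x | (k : ℕ∞) ≤ x} = {n | k ≤ n} := by
    ext n; simp
  rw [h2]
  apply poissonMeasure_tail_le
  have : ((Λ B).toNNReal : ℝ) ≤ k / 4 := ENNReal.toReal_le_of_le_ofReal (by positivity) hk
  linarith

theorem IsPoissonProcess.measure_inter_eq_empty_le (h : IsPoissonProcess Λ P S) {B : Set E}
    (hB : MeasurableSet B) {m : ℝ} (htop : Λ B ≠ ⊤) (hm : ENNReal.ofReal m ≤ Λ B) :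
    P {ω | S ω ∩ B = ∅} ≤ ENNReal.ofReal (Real.exp (-m)) := by
  have h1 := (h.hasLaw_count B hB htop).measure_eq (p := fun j => j = 0)
    (MeasurableSet.of_discrete)
  simp only [Set.encard_eq_zero] at h1
  rw [h1, Measure.map_apply (by fun_prop) MeasurableSet.of_discrete]
  have h2 : (fun n : ℕ => (n : ℕ∞)) ⁻¹' {x | x = 0} = {0} := by
    ext n; simp
  rw [h2, poissonMeasure_singleton]
  apply ENNReal.ofReal_le_ofReal
  have : m ≤ ((Λ B).toNNReal : ℝ) := (ENNReal.ofReal_le_iff_le_toReal htop).1 hm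
  simpa using this

end Counts

/-! ### Tails of the Gumbel law -/

section Gumbel

theorem gumbelMeasure_Ioi_le (a : ℝ) :
    gumbelMeasure (Set.Ioi a) ≤ ENNReal.ofReal (Real.exp (-a)) := by
  rw [gumbelMeasure, withDensity_apply _ measurableSet_Ioi, ← integral_exp_neg_Ioi a,
    ofReal_integral_eq_lintegral_ofReal (integrableOn_exp_neg_Ioi a)
      (Filter.Eventually.of_forall fun x => (Real.exp_pos _).le)]
  refine lintegral_mono fun x => ENNReal.ofReal_le_ofReal ?_
  exact mul_le_of_le_one_right (Real.exp_pos _).le (Real.exp_le_one_iff.2 (by simp [Real.exp_nonneg]))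

/-- With `w = e^(-x)`, half of the exponent in `e^(-w)` gives the decay at `a`; the other half, at
most `8 / w²`, turns the density into a multiple of the integrable `e^x = 1 / w`. -/
theorem gumbelMeasure_Iic_le (a : ℝ) :
    gumbelMeasure (Set.Iic a) ≤
      ENNReal.ofReal (8 * Real.exp (-(Real.exp (-a) / 2)) * Real.exp a) := by
  rw [gumbelMeasure, withDensity_apply _ measurableSet_Iic, ← integral_exp_Iic a,
    ← integral_const_mul,
    ofReal_integral_eq_lintegral_ofReal ((integrableOn_exp_Iic a).const_mul _)
      (Filter.Eventually.of_forall fun x => by positivity)]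
  refine setLIntegral_mono' measurableSet_Iic fun x hx => ENNReal.ofReal_le_ofReal ?_
  set w := Real.exp (-x) with hw
  have hwpos : 0 < w := Real.exp_pos _
  have hxw : Real.exp x = 1 / w := by rw [hw, Real.exp_neg]; simp
  have haw : Real.exp (-a) ≤ w := Real.exp_le_exp.2 (neg_le_neg hx)
  have h1 : Real.exp (-w) ≤ Real.exp (-(Real.exp (-a) / 2)) * Real.exp (-(w / 2)) := by
    rw [← Real.exp_add]; apply Real.exp_le_exp.2; linarith
  have h2 : Real.exp (-(w / 2)) ≤ 8 / w ^ 2 := by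
    rw [Real.exp_neg, inv_eq_one_div, div_le_div_iff₀ (Real.exp_pos _) (by positivity)]
    have := Real.quadratic_le_exp_of_nonneg (x := w / 2) (by positivity)
    nlinarith
  calc w * Real.exp (-w)
      ≤ w * (Real.exp (-(Real.exp (-a) / 2)) * (8 / w ^ 2)) := by
        gcongr; exact h1.trans (by gcongr)
    _ = _ := by rw [hxw]; field_simp

theorem gumbelMeasure_univ_le : gumbelMeasure Set.univ ≤ 9 := by
  rw [← Set.Iic_union_Ioi (a := (0 : ℝ))]
  refine (measure_union_le _ _).trans ?_
  have h1 : gumbelMeasure (Set.Iic 0) ≤ ENNReal.ofReal 8 := by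
    refine (gumbelMeasure_Iic_le 0).trans (ENNReal.ofReal_le_ofReal ?_)
    have : Real.exp (-(Real.exp (-0) / 2)) ≤ 1 := Real.exp_le_one_iff.2 (by simp)
    simp only [Real.exp_zero, mul_one]; linarith
  have h2 := gumbelMeasure_Ioi_le 0
  calc _ ≤ ENNReal.ofReal 8 + ENNReal.ofReal (Real.exp (-0)) := add_le_add h1 h2
    _ = 9 := by
      rw [← ENNReal.ofReal_add (by norm_num) (by positivity)]; norm_num

end Gumbel

/-! ### Exponential sums over lattice points -/

section Sums

theorem sum_mul_exp_le {a t : ℝ} (ha : 0 < a) (ht : 0 < t) (I : Finset ℕ)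
    (hI : ∀ i ∈ I, a * Real.exp i < t) : ∑ i ∈ I, a * Real.exp i ≤ 2 * t := by
  have hgeom : ∀ m : ℕ, ∑ i ∈ Finset.range (m + 1), Real.exp i ≤ 2 * Real.exp m := by
    intro m
    induction m with
    | zero => simp
    | succ m ih =>
      rw [Finset.sum_range_succ]
      push_cast
      rw [Real.exp_add]
      have := Real.add_one_le_exp 1
      nlinarith [Real.exp_pos m]
  rcases I.eq_empty_or_nonempty with rfl | hne
  · simp [ht.le]
  · have hsub : I ⊆ Finset.range (I.max' hne + 1) := fun i hi =>
      Finset.mem_range.2 (Nat.lt_succ_of_le (I.le_max' i hi))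
    rw [← Finset.mul_sum]
    calc a * ∑ i ∈ I, Real.exp i ≤ a * (2 * Real.exp (I.max' hne)) := by
          gcongr
          exact (Finset.sum_le_sum_of_subset_of_nonneg hsub fun _ _ _ => (Real.exp_pos _).le).trans
            (hgeom _)
      _ = 2 * (a * Real.exp (I.max' hne)) := by ring
      _ ≤ 2 * t := by gcongr; exact (hI _ (I.max'_mem hne)).le

/-- Fixing all coordinates but one leaves part of a geometric progression bounded by `t`, whose sum
is at most `2 * t`. Thus one coordinate costs no factor `N`, which keeps the light mass at order
`t^d` in dimension `d`. -/
theorem sum_filter_mul_exp_sum_le {a t : ℝ} (ha : 0 < a) (ht : 0 < t) (d N : ℕ) :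
    ∑ n ∈ (Fintype.piFinset fun _ : Fin (d + 1) => Finset.range N) with
      a * Real.exp (∑ j, (n j : ℝ)) < t, a * Real.exp (∑ j, (n j : ℝ)) ≤ N ^ d * (2 * t) := by
  set F := (Fintype.piFinset fun _ : Fin (d + 1) => Finset.range N).filter
    fun n => a * Real.exp (∑ j, (n j : ℝ)) < t with hF
  have hmaps : ∀ n ∈ F, Fin.tail n ∈ Fintype.piFinset fun _ : Fin d => Finset.range N := by
    intro n hn
    rw [Fintype.mem_piFinset]
    intro j
    exact Fintype.mem_piFinset.1 (Finset.mem_filter.1 hn).1 j.succ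
  rw [← Finset.sum_fiberwise_of_maps_to hmaps]
  have hcard : ((Fintype.piFinset fun _ : Fin d => Finset.range N).card : ℝ) = N ^ d := by
    simp
  rw [← hcard, ← nsmul_eq_mul]
  apply Finset.sum_le_card_nsmul
  intro m _
  have hsplit : ∀ n ∈ F.filter (fun n => Fin.tail n = m), a * Real.exp (∑ j, (n j : ℝ)) =
      (a * Real.exp (∑ j, (m j : ℝ))) * Real.exp (n 0) := by
    intro n hn
    rw [← (Finset.mem_filter.1 hn).2, Fin.sum_univ_succ, Real.exp_add]
    simp only [Fin.tail]; ring
  have hinj : Set.InjOn (fun n : Fin (d + 1) → ℕ => n 0) (F.filter (fun n => Fin.tail n = m)) := by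
    intro n hn n' hn' h0
    rw [← Fin.cons_self_tail n, ← Fin.cons_self_tail n', (Finset.mem_filter.1 hn).2,
      (Finset.mem_filter.1 hn').2]
    congr
  rw [Finset.sum_congr rfl hsplit,
    ← Finset.sum_image (f := fun i : ℕ => (a * Real.exp (∑ j, (m j : ℝ))) * Real.exp i) hinj]
  apply sum_mul_exp_le (by positivity) ht
  intro i hi
  obtain ⟨n, hn, rfl⟩ := Finset.mem_image.1 hi
  rw [← hsplit n hn]
  exact (Finset.mem_filter.1 (Finset.mem_filter.1 hn).1).2

theorem tsum_exp_neg_sum_ne_top (d : ℕ) :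
    ∑' n : Fin d → ℕ, ENNReal.ofReal (Real.exp (-∑ j, (n j : ℝ))) ≠ ⊤ := by
  induction d with
  | zero => simp [tsum_fintype]
  | succ d ih =>
    rw [← (Fin.consEquiv fun _ => ℕ).tsum_eq, ENNReal.tsum_prod']
    simp only [Fin.consEquiv_apply, Fin.sum_univ_succ, Fin.cons_zero, Fin.cons_succ, neg_add,
      Real.exp_add, ENNReal.ofReal_mul (Real.exp_pos _).le, ENNReal.tsum_mul_left,
      ENNReal.tsum_mul_right]
    refine ENNReal.mul_ne_top ?_ ih
    have hs : Summable fun n : ℕ => Real.exp (-(n : ℝ)) := Real.summable_exp_neg_nat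
    rw [← ENNReal.ofReal_tsum_of_nonneg (fun n => (Real.exp_pos _).le) hs]
    exact ENNReal.ofReal_ne_top

end Sums

/-! ### Unit boxes, cells and their intensities -/

/-- The half-open unit box of `ℝ^d` with lower corner `b`. -/
def unitBox {d : ℕ} (b : Fin d → ℝ) : Set (Fin d → ℝ) :=
  Set.univ.pi fun j => Set.Ico (b j) (b j + 1)

theorem measurableSet_unitBox {d : ℕ} (b : Fin d → ℝ) : MeasurableSet (unitBox b) :=
  MeasurableSet.univ_pi fun _ => measurableSet_Ico

theorem volume_unitBox {d : ℕ} (b : Fin d → ℝ) : volume (unitBox b) = 1 := by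
  simp [unitBox, Real.volume_pi_Ico]

theorem intensity_unitBox_le {d : ℕ} (g : ℝ) (b : Fin d → ℝ) :
    intensity d g (unitBox b) ≤ ENNReal.ofReal (Real.exp (-∑ j, b j)) := by
  rw [intensity, withDensity_apply _ (measurableSet_unitBox b)]
  calc _ ≤ ∫⁻ _ in unitBox b, ENNReal.ofReal (Real.exp (-∑ j, b j)) := by
        refine setLIntegral_mono' (measurableSet_unitBox b) fun z hz => ?_
        refine (Set.indicator_le_self' (fun _ _ => zero_le) z).trans ?_
        apply ENNReal.ofReal_le_ofReal
        gcongr with j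
        exact (hz j trivial).1
    _ = _ := by rw [setLIntegral_const, volume_unitBox, mul_one]

theorem le_intensity_unitBox {d : ℕ} (g : ℝ) (b : Fin d → ℝ)
    (h : ∃ j, b j + 1 ≤ xPoint d g j) :
    ENNReal.ofReal (Real.exp (-∑ j, b j - d)) ≤ intensity d g (unitBox b) := by
  rw [intensity, withDensity_apply _ (measurableSet_unitBox b)]
  calc ENNReal.ofReal (Real.exp (-∑ j, b j - d))
      = ∫⁻ _ in unitBox b, ENNReal.ofReal (Real.exp (-∑ j, b j - d)) := by
        rw [setLIntegral_const, volume_unitBox, mul_one]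
    _ ≤ _ := by
        refine setLIntegral_mono' (measurableSet_unitBox b) fun z hz => ?_
        obtain ⟨i, hi⟩ := h
        have hz' : z ∈ {z | ¬ StrongLT (xPoint d g) z} := fun hlt =>
          absurd ((hz i trivial).2.trans_le hi) (hlt i).not_gt
        rw [Set.indicator_of_mem hz']
        apply ENNReal.ofReal_le_ofReal
        apply Real.exp_le_exp.2
        have : ∑ j, z j ≤ ∑ j, (b j + 1) := Finset.sum_le_sum fun j _ => (hz j trivial).2.le
        rw [Finset.sum_add_distrib] at this
        simp only [Finset.sum_const, Finset.card_univ, Fintype.card_fin, nsmul_eq_mul,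
          mul_one] at this
        linarith

/-- The point `x(g) - n` of the lattice through `x(g)`. -/
noncomputable def cellCorner {d : ℕ} (g : ℝ) (n : Fin d → ℕ) : Fin d → ℝ :=
  fun j => xPoint d g j - n j

theorem sum_xPoint {d : ℕ} (hd : d ≠ 0) (g : ℝ) : ∑ j, xPoint d g j = g := by
  simp [xPoint]; field_simp

theorem sum_cellCorner {d : ℕ} (hd : d ≠ 0) (g : ℝ) (n : Fin d → ℕ) :
    ∑ j, cellCorner g n j = g - ∑ j, (n j : ℝ) := by
  simp only [cellCorner, Finset.sum_sub_distrib, sum_xPoint hd]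

/-- The cell indexed by `n` in the partition of `{y | y ≺ x(g)}` into unit boxes. -/
noncomputable def cell {d : ℕ} (g : ℝ) (n : Fin d → ℕ) : Set (Fin d → ℝ) :=
  unitBox fun j => cellCorner g n j - 1

theorem exists_mem_cell {d : ℕ} {g : ℝ} {y : Fin d → ℝ} (h : StrongLT y (xPoint d g)) :
    ∃ n, y ∈ cell g n := by
  -- Cells are open at the top, hence the ceiling minus one; the ceiling is at least `1`, so nothing
  -- is truncated.
  refine ⟨fun j => ⌈xPoint d g j - y j⌉₊ - 1, fun j _ => ?_⟩
  have hpos : 0 < xPoint d g j - y j := sub_pos.2 (h j)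
  have h1 : 1 ≤ ⌈xPoint d g j - y j⌉₊ := Nat.one_le_ceil_iff.2 hpos
  have h2 := Nat.le_ceil (xPoint d g j - y j)
  have h3 := Nat.ceil_lt_add_one hpos.le
  simp only [cellCorner, Set.mem_Ico]
  push_cast [h1]
  constructor <;> linarith

theorem inter_unitBox_cellCorner_eq_empty {d : ℕ} {g : ℝ} {n : Fin d → ℕ} {y : Fin d → ℝ}
    {S : Set (Fin d → ℝ)} (hmax : ∀ z ∈ S, ¬ StrongLT y z) (hy : y ∈ cell g n) :
    S ∩ unitBox (cellCorner g n) = ∅ := by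
  refine Set.eq_empty_of_forall_notMem fun z hz => hmax z hz.1 fun j => ?_
  have h1 := (hy j trivial).2
  have h2 := (hz.2 j trivial).1
  simp only at h1
  linarith

theorem intensity_cell_le {d : ℕ} (hd : d ≠ 0) (g : ℝ) (n : Fin d → ℕ) :
    intensity d g (cell g n) ≤
      ENNReal.ofReal (Real.exp d * (Real.exp (-g) * Real.exp (∑ j, (n j : ℝ)))) := by
  refine (intensity_unitBox_le g _).trans_eq ?_
  rw [Finset.sum_sub_distrib, sum_cellCorner hd, ← Real.exp_add, ← Real.exp_add]
  congr 2
  simp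
  ring

/-- If `n i ≥ 1`, the box stays below `x(g)` in coordinate `i`, so the indicator is `1` on it. For
`n = 0` the box lies above `x(g)` and carries no mass. -/
theorem le_intensity_unitBox_cellCorner {d : ℕ} (hd : d ≠ 0) (g : ℝ) {n : Fin d → ℕ}
    (hn : n ≠ 0) :
    ENNReal.ofReal (Real.exp (-d) * (Real.exp (-g) * Real.exp (∑ j, (n j : ℝ)))) ≤
      intensity d g (unitBox (cellCorner g n)) := by
  obtain ⟨i, hi⟩ := Function.ne_iff.1 hn
  refine le_trans (le_of_eq ?_) (le_intensity_unitBox g _ ⟨i, ?_⟩)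
  · rw [sum_cellCorner hd, ← Real.exp_add, ← Real.exp_add]
    congr 2
    ring
  · have : (1 : ℝ) ≤ n i := by exact_mod_cast Nat.one_le_iff_ne_zero.2 hi
    simp only [cellCorner]
    linarith

/-- The probability that a Poisson process with intensity `intensity d g` has a maximum in the
cell indexed by `n ≠ 0` is at most that of the box just above being empty. -/
theorem measure_inter_unitBox_eq_empty_le {d : ℕ} (hd : d ≠ 0) {Ω : Type*} [MeasurableSpace Ω]
    {P : Measure Ω} {S : Ω → Set (Fin d → ℝ)} {g t : ℝ}
    (h : IsPoissonProcess (intensity d g) P S) {n : Fin d → ℕ} (hn0 : n ≠ 0)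
    (hn : t ≤ Real.exp (-g) * Real.exp (∑ j, (n j : ℝ))) :
    P {ω | S ω ∩ unitBox (cellCorner g n) = ∅} ≤
      ENNReal.ofReal (2 * Real.exp d * Real.exp g * Real.exp (-(Real.exp (-d) * t / 2))) *
        ENNReal.ofReal (Real.exp (-∑ j, (n j : ℝ))) := by
  have htop := ne_top_of_le_ne_top ENNReal.ofReal_ne_top
    (intensity_unitBox_le g (cellCorner g n))
  refine (h.measure_inter_eq_empty_le (measurableSet_unitBox _) htop
    (le_intensity_unitBox_cellCorner hd g hn0)).trans ?_
  rw [← ENNReal.ofReal_mul (by positivity)]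
  apply ENNReal.ofReal_le_ofReal
  set w := Real.exp (-d) * (Real.exp (-g) * Real.exp (∑ j, (n j : ℝ))) with hw
  have hwpos : 0 < w := by positivity
  -- One half of the exponent is kept at the threshold `t`; the other is traded for `2 / w`, which
  -- is summable over `n`.
  have h1 : Real.exp (-w) ≤ Real.exp (-(Real.exp (-d) * t / 2)) * Real.exp (-(w / 2)) := by
    rw [← Real.exp_add]
    apply Real.exp_le_exp.2
    have := mul_le_mul_of_nonneg_left hn (Real.exp_pos (-(d : ℝ))).le
    linarith
  have h2 : Real.exp (-(w / 2)) ≤ 2 / w := by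
    rw [Real.exp_neg, inv_eq_one_div, div_le_div_iff₀ (Real.exp_pos _) hwpos]
    have := Real.add_one_le_exp (w / 2)
    linarith
  have h3 : 2 / w = 2 * Real.exp d * Real.exp g * Real.exp (-∑ j, (n j : ℝ)) := by
    rw [hw]
    simp only [Real.exp_neg]
    field_simp
  calc Real.exp (-w) ≤ Real.exp (-(Real.exp (-d) * t / 2)) * (2 / w) := h1.trans (by gcongr)
    _ = _ := by rw [h3]; ring

/-! ### Tail of the number of maxima for fixed `g` -/

theorem measure_numMaximaBelow_ge_le {d : ℕ} (hd : d ≠ 0) {Ω : Type*} [MeasurableSpace Ω]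
    {P : Measure Ω} {S : Ω → Set (Fin d → ℝ)} {g t : ℝ}
    (h : IsPoissonProcess (intensity d g) P S) (ht : 1 ≤ t) (hg : -Real.log t < g) (hgt : g ≤ t)
    {k : ℕ} (hk : 8 * (3 * Real.exp 1 * t) ^ d ≤ k) :
    P {ω | (k : ℕ∞) ≤ numMaximaBelow (S ω) (xPoint d g)} ≤
      ENNReal.ofReal (Real.exp (-(k / 2 : ℝ))) +
      ENNReal.ofReal (2 * Real.exp d * Real.exp g * Real.exp (-(Real.exp (-d) * t / 2))) *
        ∑' n : Fin d → ℕ, ENNReal.ofReal (Real.exp (-∑ j, (n j : ℝ))) := by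
  have ht0 : 0 < t := by linarith
  set w : (Fin d → ℕ) → ℝ := fun n => Real.exp (-g) * Real.exp (∑ j, (n j : ℝ)) with hw
  set N := ⌈2 * t⌉₊ with hN
  set F := (Fintype.piFinset fun _ : Fin d => Finset.range N).filter fun n => w n < t with hF
  set R := ⋃ n ∈ F, cell g n with hR
  have hRmeas : MeasurableSet R :=
    F.measurableSet_biUnion fun n _ => measurableSet_unitBox _
  -- A light cell has `|n| < g + log t < 2 * t`, by `g ≤ t`; hence the choice of `N`.
  have hmemF : ∀ n, w n < t → n ∈ F := by
    intro n hn
    refine Finset.mem_filter.2 ⟨Fintype.mem_piFinset.2 fun j => Finset.mem_range.2 ?_, hn⟩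
    have h1 : ∑ j, (n j : ℝ) < g + Real.log t := by
      have : Real.exp (-g + ∑ j, (n j : ℝ)) < t := by rw [Real.exp_add]; exact hn
      have := (Real.lt_log_iff_exp_lt ht0).2 this
      linarith
    have h2 : (n j : ℝ) ≤ ∑ j, (n j : ℝ) :=
      Finset.single_le_sum (f := fun j => (n j : ℝ)) (fun _ _ => Nat.cast_nonneg _)
        (Finset.mem_univ j)
    have h3 := Real.log_le_sub_one_of_pos ht0
    have h4 := Nat.le_ceil (2 * t)
    have : (n j : ℝ) < N := by linarith
    exact_mod_cast this
  have hRle : intensity d g R ≤ ENNReal.ofReal (k / 4) := by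
    calc intensity d g R ≤ ∑ n ∈ F, intensity d g (cell g n) := measure_biUnion_finset_le _ _
      _ ≤ ∑ n ∈ F, ENNReal.ofReal (Real.exp d * w n) :=
        Finset.sum_le_sum fun n _ => intensity_cell_le hd g n
      _ = ENNReal.ofReal (∑ n ∈ F, Real.exp d * w n) :=
        (ENNReal.ofReal_sum_of_nonneg fun n _ => by positivity).symm
      _ ≤ _ := by
        apply ENNReal.ofReal_le_ofReal
        rw [← Finset.mul_sum]
        obtain ⟨d, rfl⟩ := Nat.exists_eq_succ_of_ne_zero hd
        have h1 := sum_filter_mul_exp_sum_le (Real.exp_pos (-g)) ht0 d N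
        have h2 : (N : ℝ) ≤ 3 * t := by
          have := Nat.ceil_lt_add_one (a := 2 * t) (by positivity)
          linarith
        calc _ ≤ Real.exp (d.succ : ℕ) * ((3 * t) ^ d * (2 * t)) := by
              gcongr
              exact h1.trans (by gcongr)
          _ ≤ Real.exp (d.succ : ℕ) * ((3 * t) ^ d * (2 * (3 * t))) := by
              gcongr; linarith
          _ = 2 * (3 * Real.exp 1 * t) ^ d.succ := by
              have : Real.exp (d.succ : ℕ) = Real.exp 1 ^ d.succ := by
                rw [← Real.exp_nat_mul, mul_one]
              rw [this, mul_pow, mul_pow, mul_pow, Nat.succ_eq_add_one]; ring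
          _ ≤ k / 4 := by linarith
  have hsub : {ω | (k : ℕ∞) ≤ numMaximaBelow (S ω) (xPoint d g)} ⊆
      {ω | (k : ℕ∞) ≤ (S ω ∩ R).encard} ∪
        ⋃ n ∈ {n : Fin d → ℕ | t ≤ w n}, {ω | S ω ∩ unitBox (cellCorner g n) = ∅} := by
    intro ω hω
    by_contra hcon
    simp only [Set.mem_union, Set.mem_iUnion, not_or, not_exists] at hcon
    obtain ⟨hc1, hc2⟩ := hcon
    apply hc1
    refine le_trans (show (k : ℕ∞) ≤ _ from hω) (Set.encard_le_encard ?_)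
    rintro y ⟨hyS, hymax, hyx⟩
    obtain ⟨n, hn⟩ := exists_mem_cell hyx
    refine ⟨hyS, Set.mem_biUnion (hmemF n ?_) hn⟩
    by_contra hnt
    exact hc2 n (not_lt.1 hnt) (inter_unitBox_cellCorner_eq_empty hymax hn)
  -- The condition `-log t < g` makes the exceptional cell `n = 0` light.
  have hzero : ∀ n : Fin d → ℕ, t ≤ w n → n ≠ 0 := by
    rintro n hn rfl
    have : Real.exp (-g) < t := (Real.lt_log_iff_exp_lt ht0).1 (by linarith)
    simp only [hw, Pi.zero_apply, Nat.cast_zero, Finset.sum_const_zero, Real.exp_zero,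
      mul_one] at hn
    linarith
  refine (measure_mono hsub).trans ((measure_union_le _ _).trans (add_le_add
    (h.measure_le_encard_le hRmeas k hRle) ?_))
  rw [← ENNReal.tsum_mul_left]
  refine (measure_iUnion_le _).trans (ENNReal.tsum_le_tsum fun n => ?_)
  by_cases hn : t ≤ w n
  · refine le_trans (measure_mono ?_) (measure_inter_unitBox_eq_empty_le hd h (hzero n hn) hn)
    exact Set.iUnion_subset fun _ => subset_rfl
  · simp [hn]

/-! ### Mixing over the Gumbel law -/

theorem IsLawOfK.measure_ge_le {d : ℕ} (hd : d ≠ 0) {μ : Measure ℕ∞} (hμ : IsLawOfK d μ) {t : ℝ}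
    (ht : 1 ≤ t) {k : ℕ} (hk : 8 * (3 * Real.exp 1 * t) ^ d ≤ k) :
    μ {j | (k : ℕ∞) ≤ j} ≤
      ENNReal.ofReal (Real.exp (-(Real.exp (-d) * t / 4))) *
        (18 + 18 * (ENNReal.ofReal (Real.exp d) *
          ∑' n : Fin d → ℕ, ENNReal.ofReal (Real.exp (-∑ j, (n j : ℝ))))) := by
  obtain ⟨κ, hκ, rfl⟩ := hμ
  have ht0 : 0 < t := by linarith
  set A := ∑' n : Fin d → ℕ, ENNReal.ofReal (Real.exp (-∑ j, (n j : ℝ))) with hA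
  set c := Real.exp (-(d : ℝ)) with hc
  have hc1 : c ≤ 1 := Real.exp_le_one_iff.2 (by simp)
  have hcpos : 0 < c := Real.exp_pos _
  have hct : c * t ≤ t := mul_le_of_le_one_left ht0.le hc1
  have hct0 : 0 < c * t := by positivity
  set q := ENNReal.ofReal (Real.exp (-(c * t / 4))) with hq
  -- Needed to absorb `exp (-k / 2)` into `q`.
  have htk : t ≤ k := by
    have h1 : 1 ≤ 3 * Real.exp 1 := by linarith [Real.add_one_le_exp 1]
    have h2 : t ≤ 3 * Real.exp 1 * t := le_mul_of_one_le_left ht0.le h1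
    have h3 : 3 * Real.exp 1 * t ≤ (3 * Real.exp 1 * t) ^ d :=
      le_self_pow₀ (ht.trans h2) hd
    have h4 : 0 ≤ (3 * Real.exp 1 * t) ^ d := by positivity
    linarith
  have hmid : ∀ g ∈ Set.Ioc (-Real.log t) (c * t / 4),
      κ g {j | (k : ℕ∞) ≤ j} ≤ q * (1 + 2 * (ENNReal.ofReal (Real.exp d) * A)) := by
    rintro g ⟨hg1, hg2⟩
    obtain ⟨Ω, _, P, S, hS, hlaw⟩ := hκ g
    rw [← hlaw.measure_eq (p := fun j => (k : ℕ∞) ≤ j) MeasurableSet.of_discrete]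
    refine (measure_numMaximaBelow_ge_le hd hS ht hg1 (by linarith) hk).trans ?_
    rw [mul_add, mul_one]
    refine add_le_add (ENNReal.ofReal_le_ofReal (Real.exp_le_exp.2 (by linarith))) ?_
    have h1 : ENNReal.ofReal (2 * Real.exp d * Real.exp g * Real.exp (-(c * t / 2))) ≤
        q * (2 * ENNReal.ofReal (Real.exp d)) := by
      rw [hq, ← ENNReal.ofReal_ofNat, ← ENNReal.ofReal_mul (by norm_num),
        ← ENNReal.ofReal_mul (by positivity)]
      apply ENNReal.ofReal_le_ofReal
      have : Real.exp g * Real.exp (-(c * t / 2)) ≤ Real.exp (-(c * t / 4)) := by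
        rw [← Real.exp_add]
        exact Real.exp_le_exp.2 (by linarith)
      calc _ = 2 * Real.exp d * (Real.exp g * Real.exp (-(c * t / 2))) := by ring
        _ ≤ 2 * Real.exp d * Real.exp (-(c * t / 4)) := by gcongr
        _ = _ := by ring
    calc _ ≤ q * (2 * ENNReal.ofReal (Real.exp d)) * A := by gcongr
      _ = _ := by ring
  have hle1 : ∀ g, κ g {j | (k : ℕ∞) ≤ j} ≤ 1 := by
    intro g
    obtain ⟨Ω, _, P, S, hS, hlaw⟩ := hκ g
    have := hS.isProbabilityMeasure
    rw [← hlaw.measure_eq (p := fun j => (k : ℕ∞) ≤ j) MeasurableSet.of_discrete]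
    exact prob_le_one
  have hcover : (Set.univ : Set ℝ) ⊆
      (Set.Iic (-Real.log t) ∪ Set.Ioi (c * t / 4)) ∪ Set.Ioc (-Real.log t) (c * t / 4) := by
    intro g _
    by_cases h1 : g ≤ -Real.log t
    · exact Or.inl (Or.inl h1)
    · by_cases h2 : g ≤ c * t / 4
      · exact Or.inr ⟨not_le.1 h1, h2⟩
      · exact Or.inl (Or.inr (not_le.1 h2))
  have hlow : gumbelMeasure (Set.Iic (-Real.log t)) ≤ q * 8 := by
    refine (gumbelMeasure_Iic_le _).trans ?_
    rw [neg_neg, Real.exp_log ht0, Real.exp_neg (Real.log t), Real.exp_log ht0, hq,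
      ← ENNReal.ofReal_ofNat, ← ENNReal.ofReal_mul (by positivity)]
    apply ENNReal.ofReal_le_ofReal
    have h1 : Real.exp (-(t / 2)) ≤ Real.exp (-(c * t / 4)) :=
      Real.exp_le_exp.2 (by linarith)
    have h2 : t⁻¹ ≤ 1 := inv_le_one_of_one_le₀ ht
    calc 8 * Real.exp (-(t / 2)) * t⁻¹ ≤ 8 * Real.exp (-(c * t / 4)) * 1 := by gcongr
      _ = _ := by ring
  rw [Measure.bind_apply MeasurableSet.of_discrete κ.aemeasurable, ← setLIntegral_univ]
  calc ∫⁻ g in Set.univ, κ g {j | (k : ℕ∞) ≤ j} ∂gumbelMeasure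
      ≤ (∫⁻ g in Set.Iic (-Real.log t), κ g {j | (k : ℕ∞) ≤ j} ∂gumbelMeasure +
          ∫⁻ g in Set.Ioi (c * t / 4), κ g {j | (k : ℕ∞) ≤ j} ∂gumbelMeasure) +
          ∫⁻ g in Set.Ioc (-Real.log t) (c * t / 4), κ g {j | (k : ℕ∞) ≤ j} ∂gumbelMeasure :=
        (lintegral_mono_set hcover).trans ((lintegral_union_le _ _ _).trans
          (add_le_add_left (lintegral_union_le _ _ _) _))
    _ ≤ (q * 8 + q) + (q * (1 + 2 * (ENNReal.ofReal (Real.exp d) * A))) * 9 := by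
        refine add_le_add (add_le_add ?_ ?_) ?_
        · refine (lintegral_mono fun g => hle1 g).trans ?_
          rw [lintegral_one, Measure.restrict_apply_univ]
          exact hlow
        · refine (lintegral_mono fun g => hle1 g).trans ?_
          rw [lintegral_one, Measure.restrict_apply_univ]
          exact gumbelMeasure_Ioi_le _
        · refine (setLIntegral_mono' measurableSet_Ioc hmid).trans ?_
          rw [setLIntegral_const]
          gcongr
          exact (measure_mono (Set.subset_univ _)).trans gumbelMeasure_univ_le
    _ = _ := by ring

end ParetoRecords

/-! ### Choice of the threshold and conclusion -/

theorem theorem4p2 (d : ℕ) (hd : 2 ≤ d) :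
    ∃ c : ℝ, 0 < c ∧ ∀ᶠ k : ℕ in Filter.atTop,
      ∀ μ : MeasureTheory.Measure ℕ∞, ParetoRecords.IsLawOfK d μ →
        μ {j : ℕ∞ | (k : ℕ∞) ≤ j} ≤
          ENNReal.ofReal
            (Real.exp (-(c * (k : ℝ) ^ (((d : ℝ) - 1) / ((d : ℝ) ^ 2 - 2))))) := by
  have hd0 : d ≠ 0 := by omega
  have hdR : (2 : ℝ) ≤ d := by exact_mod_cast hd
  set K : ENNReal := 18 + 18 * (ENNReal.ofReal (Real.exp d) *
    ∑' n : Fin d → ℕ, ENNReal.ofReal (Real.exp (-∑ j, (n j : ℝ)))) with hK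
  have hKtop : K ≠ ⊤ := ENNReal.add_ne_top.2 ⟨by simp, ENNReal.mul_ne_top (by simp)
    (ENNReal.mul_ne_top ENNReal.ofReal_ne_top (ParetoRecords.tsum_exp_neg_sum_ne_top d))⟩
  -- With `t = ε * k^(1/d)`, `8 * (3 * e * t)^d = 8 * k / 8^d ≤ k`.
  set ε : ℝ := 1 / (24 * Real.exp 1) with hε
  have hεpos : 0 < ε := by positivity
  set δ : ℝ := Real.exp (-d) * ε / 4 with hδ
  have hδpos : 0 < δ := by positivity
  have hpow : Filter.Tendsto (fun k : ℕ => (k : ℝ) ^ (1 / (d : ℝ))) Filter.atTop Filter.atTop :=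
    (tendsto_rpow_atTop (by positivity)).comp tendsto_natCast_atTop_atTop
  have hexp : Filter.Tendsto (fun k : ℕ => Real.exp (δ / 2 * (k : ℝ) ^ (1 / (d : ℝ))))
      Filter.atTop Filter.atTop :=
    Real.tendsto_exp_atTop.comp (hpow.const_mul_atTop (by positivity))
  -- The other half of the rate `δ` absorbs the constant `K` for large `k`.
  refine ⟨δ / 2, by positivity, ?_⟩
  filter_upwards [hpow.eventually_ge_atTop (1 / ε), hexp.eventually_ge_atTop K.toReal,
    Filter.eventually_ge_atTop 1] with k hk1 hk2 hk3 μ hμ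
  set s : ℝ := (k : ℝ) ^ (1 / (d : ℝ)) with hs
  have hsd : s ^ d = k := by
    rw [hs, ← Real.rpow_natCast, ← Real.rpow_mul (Nat.cast_nonneg k),
      one_div_mul_cancel (by positivity), Real.rpow_one]
  have ht : 1 ≤ ε * s := by
    rw [mul_comm]; exact (div_le_iff₀ hεpos).1 hk1
  have hk : 8 * (3 * Real.exp 1 * (ε * s)) ^ d ≤ k := by
    have h1 : 3 * Real.exp 1 * (ε * s) = 1 / 8 * s := by
      rw [hε]; field_simp; ring
    rw [h1, mul_pow, hsd]
    have h2 : ((1 : ℝ) / 8) ^ d ≤ 1 / 8 := pow_le_of_le_one (by norm_num) (by norm_num) hd0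
    have h3 : (0 : ℝ) ≤ k := Nat.cast_nonneg k
    nlinarith
  refine (hμ.measure_ge_le hd0 ht hk).trans ?_
  rw [← hK, ← ENNReal.ofReal_toReal hKtop, ← ENNReal.ofReal_mul (Real.exp_pos _).le]
  apply ENNReal.ofReal_le_ofReal
  have hexpo : (k : ℝ) ^ (((d : ℝ) - 1) / ((d : ℝ) ^ 2 - 2)) ≤ s := by
    apply Real.rpow_le_rpow_of_exponent_le (by exact_mod_cast hk3)
    rw [div_le_div_iff₀ (by nlinarith) (by positivity)]
    nlinarith
  calc Real.exp (-(Real.exp (-d) * (ε * s) / 4)) * K.toReal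
      ≤ Real.exp (-(Real.exp (-d) * (ε * s) / 4)) * Real.exp (δ / 2 * s) := by gcongr
    _ = Real.exp (-(δ / 2 * s)) := by rw [← Real.exp_add, hδ]; congr 1; ring
    _ ≤ _ := by gcongr
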